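/- Let $d\in\mathbb N$ and let $(B_t)_{t\ge 0}$ be a standard Brownian motion on $\mathbb R^d$ with $B_0=0$; put $B^x_t:=x+B_t$. For $x,y\in\mathbb R^d$ let $H_{x,y}:=\{z:|x-z|=|y-z|\}$, let $\tau:=\inf\{t>0: B^x_t\in H_{x,y}\}$ (with $\inf\emptyset=\infty$; $\tau=0$ if $x=y$), and let $$R_{x,y}z:=z-2\Big\langle z-\frac{x+y}{2},\,x-y\Big\rangle\frac{x-y}{|x-y|^2}\quad(x\ne y),\qquad R_{x,x}z:=z .$$ The reflection coupling of Brownian motion started at $(x,y)$ is the process $(B^x_t,Y^{x,y}_t)_{t\ge0}$ on $\mathbb R^{2d}$ with $Y^{x,y}_t:=R_{x,y}B^x_t$ for $t<\tau$ and $Y^{x,y}_t:=B^x_t$ for $t\ge\tau$. Then every twice continuously differentiable function $f:\mathbb R^d\times\mathbb R^d\to\mathbb R$ that vanishes at infinity belongs to the domain of the extended pointwise generator $A$ of the reflection coupling, and $A$ is given on $f$ as follows: for all $x,y\in\mathbb R^d$ the expectations $\mathbb E f(B^x_t,Y^{x,y}_t)$, $t\ge 0$, exist, and $$Af(x,y):=\lim_{t\downarrow0}\frac{\mathbb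 E f(B^x_t,Y^{x,y}_t)-f(x,y)}{t}=\frac12\Delta f(x,y)+\sum_{i=1}^d\sum_{k=1}^d\Big(\delta_{ik}-2\,\frac{(x_i-y_i)(x_k-y_k)}{|x-y|^2}\Big)\partial_{x_i}\partial_{y_k}f(x,y),$$ where $\Delta$ is the Laplacian on $\mathbb R^{2d}$, $\delta_{ik}$ is the Kronecker delta, and $\frac00:=0$. -/

import Mathlib

open MeasureTheory ProbabilityTheory Filter Topology
open scoped NNReal ENNReal ZeroAtInfty

noncomputable section

/-- The Euclidean space `ℝ^d`. -/
abbrev Euc (d : ℕ) : Type := EuclideanSpace ℝ (Fin d)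

/-- The Euclidean space `ℝ^{2d} = ℝ^d × ℝ^d`, with the Euclidean (not the sup) norm; the point
`(x, y)` is `WithLp.toLp 2 (x, y)`. -/
abbrev EucPair (d : ℕ) : Type := WithLp 2 (Euc d × Euc d)

/-- Standard Brownian motion on `ℝ^d` started at `0`: the coordinates are independent real
Brownian motions. -/
structure IsBrownianEuc {d : ℕ} {Ω : Type*} [MeasurableSpace Ω]
    (B : ℝ≥0 → Ω → Euc d) (P : Measure Ω) : Prop where
  isBrownianReal : ∀ i : Fin d, IsBrownianReal (fun t ω => B t ω i) P
  iIndepFun_coord : iIndepFun (fun (i : Fin d) (ω : Ω) (t : ℝ≥0) => B t ω i) P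

/-- The set `H_{x,y} = {z : |x - z| = |y - z|}`. It is a hyperplane if `x ≠ y`, and the whole space
if `x = y`. -/
def mirror {d : ℕ} (x y : Euc d) : Set (Euc d) := {z | ‖x - z‖ = ‖y - z‖}

/-- The reflection `R_{x,y} z = z - 2 ⟨z - (x+y)/2, x-y⟩ (x-y) / |x-y|^2` on `H_{x,y}`. For `x = y`
the scalar factor is `0 / 0 = 0`, so that `R_{x,x} z = z`. -/
def mirrorReflect {d : ℕ} (x y z : Euc d) : Euc d :=
  z - (2 * inner ℝ (z - (2⁻¹ : ℝ) • (x + y)) (x - y) / ‖x - y‖ ^ 2) • (x - y)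

/-- The hitting time `inf {t > 0 : X_t ∈ H}` of a set by a path, with values in `[0, ∞]` and with
`inf ∅ = ∞`. For `H = H_{x,x}`, the whole space, it is `0`. -/
def hitTime {d : ℕ} (H : Set (Euc d)) (X : ℝ≥0 → Euc d) : ℝ≥0∞ :=
  ⨅ (t : ℝ≥0) (_ : 0 < t ∧ X t ∈ H), (t : ℝ≥0∞)

open scoped Classical in
/-- The path `R^τ_{x,y} X`: it is `R_{x,y} X_t` for `t < τ` and `X_t` for `t ≥ τ`, where `τ` is the
hitting time of `H_{x,y}` by `X`. -/
def reflectUntilHit {d : ℕ} (x y : Euc d) (X : ℝ≥0 → Euc d) (t : ℝ≥0) : Euc d :=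
  if (t : ℝ≥0∞) < hitTime (mirror x y) X then mirrorReflect x y (X t) else X t

/-- Reflection coupling of Brownian motion: the family, indexed by the starting point `p = (x, y)`,
of the processes `(B^x_t, (R^τ_{x,y} B^x)_t)` with `B^x_t = x + B_t`. -/
def reflectionCoupling {d : ℕ} {Ω : Type*} (B : ℝ≥0 → Ω → Euc d) (p : EucPair d)
    (t : ℝ≥0) (ω : Ω) : EucPair d :=
  WithLp.toLp 2 (p.fst + B t ω, reflectUntilHit p.fst p.snd (fun s => p.fst + B s ω) t)

/-- `T_t f (p) = E f(X^p_t)`, for a family `X` of processes on `S` indexed by the starting point. -/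
def transitionOp {S Ω : Type*} [MeasurableSpace Ω] (X : S → ℝ≥0 → Ω → S) (P : Measure Ω)
    (t : ℝ≥0) (f : S → ℝ) (p : S) : ℝ :=
  ∫ ω, f (X p t ω) ∂P

/-- `f` (continuous and vanishing at infinity) lies in the domain of the extended pointwise
generator of the family `X`, and this generator sends `f` to `g`: all expectations `E f(X^p_t)`
exist, and `(T_t f (p) - f p) / t → g p` as `t ↓ 0`, for each point `p`. -/
def HasExtendedPointwiseGenerator {S Ω : Type*} [TopologicalSpace S] [MeasurableSpace Ω]
    (X : S → ℝ≥0 → Ω → S) (P : Measure Ω) (f : C₀(S, ℝ)) (g : S → ℝ) : Prop :=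
  ∀ p : S, (∀ t : ℝ≥0, Integrable (fun ω => f (X p t ω)) P) ∧
    Tendsto (fun t : ℝ≥0 => (transitionOp X P t f p - f p) / (t : ℝ)) (𝓝[>] 0) (𝓝 (g p))

/-- The partial derivative `∂_{x_i}` on `ℝ^d × ℝ^d`. -/
def partialFst {d : ℕ} (i : Fin d) (f : EucPair d → ℝ) (p : EucPair d) : ℝ :=
  lineDeriv ℝ f p (WithLp.toLp 2 (EuclideanSpace.single i 1, 0))

/-- The partial derivative `∂_{y_k}` on `ℝ^d × ℝ^d`. -/
def partialSnd {d : ℕ} (k : Fin d) (f : EucPair d → ℝ) (p : EucPair d) : ℝ :=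
  lineDeriv ℝ f p (WithLp.toLp 2 (0, EuclideanSpace.single k 1))

/-- The operator `½ Δ f + ∑_{i,k} (δ_{ik} - 2 (x_i-y_i)(x_k-y_k) / |x-y|^2) ∂_{x_i} ∂_{y_k} f`, where
`Δ` is the Laplacian of `ℝ^{2d}` and `0 / 0 = 0`. -/
def reflectionGenerator {d : ℕ} (f : EucPair d → ℝ) (p : EucPair d) : ℝ :=
  1 / 2 * Laplacian.laplacian f p +
    ∑ i : Fin d, ∑ k : Fin d,
      ((if i = k then (1 : ℝ) else 0) -
          2 * ((p.fst i - p.snd i) * (p.fst k - p.snd k) / ‖p.fst - p.snd‖ ^ 2)) *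
        partialFst i (partialSnd k f) p

end

/-! Write p = (x, y), and let R be the linear part of the reflection and L v = (v, R v). Before `τ`
the coupling is exactly p + L B_t, because the reflection sends x + v to y + R v
(`toLp_mirrorReflect_eq`). If x ≠ y, hitting the mirror requires |B_s| ≥ |x - y| / 2, so Doob's
inequality with fourth moments gives P(τ ≤ t) = O(t²) (`exists_measure_hitTime_le_le`). As f is
bounded, replacing the coupling by p + L B_t costs O(t²), which vanishes after division by t. If x =
y, then R is the identity and nothing has to be replaced.

What remains is the generator of B at 0 on the bounded C² function v ↦ f(p + L v), namely ½ ∑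
D²f(p)(L e_i, L e_i) (`tendsto_generator`). Since the (e_i, 0) and (0, R e_i) form an orthonormal
basis of ℝ^{2d}, this sum is the Laplacian plus the mixed terms (`reflectionGenerator_eq`). -/

namespace ProbabilityTheory

/-! ### Moments and a maximal inequality for real Brownian motion. -/

variable {Ω : Type*} [MeasurableSpace Ω] {P : Measure Ω} {B : ℝ≥0 → Ω → ℝ}

lemma integral_pow_four_gaussianReal (v : ℝ≥0) :
    ∫ x, x ^ 4 ∂gaussianReal 0 v = (∫ x, x ^ 4 ∂gaussianReal 0 1) * (v : ℝ) ^ 2 := by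
  have h := gaussianReal_map_const_mul (μ := 0) (v := 1) (√(v : ℝ))
  have hv : (NNReal.mk (√(v : ℝ) ^ 2) (sq_nonneg _) * 1 : ℝ≥0) = v := by
    ext; simp
  rw [hv, mul_zero] at h
  rw [← h, integral_map (by fun_prop) (by fun_prop), ← integral_mul_const]
  congr with x
  have : √(v : ℝ) ^ 4 = (v : ℝ) ^ 2 := by
    rw [show 4 = 2 * 2 by rfl, pow_mul, Real.sq_sqrt v.coe_nonneg]
  rw [mul_pow, this, mul_comm]

lemma integrable_pow_four_gaussianReal (v : ℝ≥0) :
    Integrable (fun x : ℝ => x ^ 4) (gaussianReal 0 v) := by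
  have := (memLp_id_gaussianReal (μ := 0) (v := v) 4).integrable_norm_pow (p := 4) (by simp)
  refine this.congr (.of_forall fun x => ?_)
  simp [Even.pow_abs (show Even 4 by decide)]

lemma IsPreBrownianReal.memLp_two_eval (hB : IsPreBrownianReal B P) (t : ℝ≥0) :
    MemLp (B t) 2 P :=
  (hB.isGaussianProcess.hasGaussianLaw_eval t).memLp_two

lemma IsPreBrownianReal.integrable_pow_four (hB : IsPreBrownianReal B P) (t : ℝ≥0) :
    Integrable (fun ω => B t ω ^ 4) P := by
  have h := hB.hasLaw_eval t
  have := integrable_pow_four_gaussianReal t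
  rw [← h.map_eq] at this
  exact this.comp_aemeasurable h.aemeasurable

lemma IsPreBrownianReal.integral_pow_four (hB : IsPreBrownianReal B P) (t : ℝ≥0) :
    ∫ ω, B t ω ^ 4 ∂P = (∫ x, x ^ 4 ∂gaussianReal 0 1) * (t : ℝ) ^ 2 := by
  rw [← integral_pow_four_gaussianReal]
  exact (hB.hasLaw_eval t).integral_comp (f := fun x => x ^ 4) (by fun_prop)

lemma IsPreBrownianReal.integral_sq (hB : IsPreBrownianReal B P) (t : ℝ≥0) :
    ∫ ω, B t ω ^ 2 ∂P = t := by
  have h := hB.covariance_eval t t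
  have := hB.isGaussianProcess.isProbabilityMeasure
  rw [covariance_self (hB.aemeasurable t),
    variance_of_integral_eq_zero (hB.aemeasurable t) (hB.integral_eval t)] at h
  simpa using h

/-- The increment after time s is centred and independent of the past up to s. -/
lemma IsPreBrownianReal.martingale (hB : IsPreBrownianReal B P)
    (hm : ∀ t, StronglyMeasurable (B t)) : Martingale B (Filtration.natural B hm) P := by
  have := hB.isGaussianProcess.isProbabilityMeasure
  refine ⟨Filtration.stronglyAdapted_natural hm, fun s t hst => ?_⟩
  have hmeas : Measurable (B t - B s) := (hm t).measurable.sub (hm s).measurable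
  have hind : Indep (MeasurableSpace.comap (B t - B s) inferInstance)
      (Filtration.natural B hm s) P := by
    rw [Filtration.natural_eq_comap]
    have h := (hB.indepFun_shift s).comp (ψ := id) (show Measurable
      (fun x : ℝ≥0 → ℝ => x (t - s)) from measurable_pi_apply _) measurable_id
    have h2 : ((fun x : ℝ≥0 → ℝ => x (t - s)) ∘ fun ω t => B (s + t) ω - B s ω) = B t - B s := by
      ext ω; simp [add_tsub_cancel_of_le hst]
    rw [h2] at h
    exact h
  have h1 := condExp_indep_eq hmeas.comap_le ((Filtration.natural B hm).le s)
    (comap_measurable (B t - B s)).stronglyMeasurable hind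
  have h2 : P[B t - B s] = 0 := by
    rw [integral_sub' (hB.integrable_eval t) (hB.integrable_eval s), hB.integral_eval,
      hB.integral_eval, sub_zero]
  have h3 := condExp_sub (hB.integrable_eval t) (hB.integrable_eval s) (Filtration.natural B hm s)
  have h4 := condExp_of_stronglyMeasurable ((Filtration.natural B hm).le s)
    (Filtration.stronglyAdapted_natural hm s) (hB.integrable_eval s)
  filter_upwards [h1, h3] with ω h1 h3
  rw [h1, h2] at h3
  simp only [Pi.sub_apply, h4] at h3
  linarith

/-- The overshoot above the level `a` of the absolute value is bounded by a multiple of the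
fourth power. -/
lemma max_abs_sub_zero_le_pow_four {a : ℝ} (ha : 0 < a) (s : ℝ) :
    max (max s (-s) - a) 0 ≤ s ^ 4 / a ^ 3 := by
  have h4 : s ^ 4 = |s| ^ 4 := (Even.pow_abs (by decide) s).symm
  have habs : max s (-s) = |s| := rfl
  rw [habs, h4]
  refine max_le ?_ (by positivity)
  rw [le_div_iff₀ (by positivity)]
  rcases le_total |s| a with h | h
  · exact (mul_nonpos_of_nonpos_of_nonneg (by linarith) (by positivity)).trans (by positivity)
  · have : a ^ 3 ≤ |s| ^ 3 := by gcongr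
    nlinarith [abs_nonneg s, pow_pos ha 3]

/-- Doob's inequality at level a for the submartingale (|B| - a)⁺, which is at least a wherever |B|
≥ 2a. Its mean is at most E B⁴ / a³, and this turns a first-moment inequality into a bound of order
t². -/
lemma IsPreBrownianReal.measure_exists_grid_le (hB : IsPreBrownianReal B P)
    (hm : ∀ t, StronglyMeasurable (B t)) {u : ℕ → ℝ≥0} (hu : Monotone u) {a : ℝ} (ha : 0 < a)
    (n : ℕ) :
    P {ω | ∃ k ≤ n, 2 * a ≤ |B (u k) ω|} ≤
      ENNReal.ofReal ((∫ x, x ^ 4 ∂gaussianReal 0 1) * (u n : ℝ) ^ 2 / a ^ 4) := by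
  have := hB.isGaussianProcess.isProbabilityMeasure
  set ℱ := Filtration.natural B hm
  let 𝒢 : Filtration ℕ ‹MeasurableSpace Ω› :=
    ⟨fun k => ℱ (u k), fun i j hij => ℱ.mono (hu hij), fun k => ℱ.le _⟩
  have hM : Martingale (fun k => B (u k)) 𝒢 P :=
    ⟨fun k => (hB.martingale hm).1 (u k), fun i j hij => (hB.martingale hm).2 _ _ (hu hij)⟩
  have hS := ((hM.submartingale.sup hM.neg.submartingale).sub_martingale
    (martingale_const 𝒢 P a)).sup (martingale_zero ℝ 𝒢 P).submartingale
  set S : ℕ → Ω → ℝ :=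
    (((fun k => B (u k)) ⊔ -(fun k => B (u k))) - (fun _ _ => a)) ⊔ 0 with hSdef
  have hSap (k : ℕ) (ω : Ω) : S k ω = max (max (B (u k) ω) (-B (u k) ω) - a) 0 := by
    simp [hSdef]
  have hS0 : 0 ≤ S := fun k ω => by rw [hSap]; exact le_max_right _ _
  have key := maximal_ineq hS hS0 (ε := a.toNNReal) n
  set A := {ω | (a.toNNReal : ℝ) ≤
    (Finset.range (n + 1)).sup' Finset.nonempty_range_add_one fun k => S k ω}
  have hsub : {ω | ∃ k ≤ n, 2 * a ≤ |B (u k) ω|} ⊆ A := by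
    rintro ω ⟨k, hk, h⟩
    refine le_trans ?_ (Finset.le_sup' (fun k => S k ω) (Finset.mem_range.2 (Nat.lt_succ_of_le hk)))
    rw [hSap, Real.coe_toNNReal a ha.le]
    refine le_max_of_le_left ?_
    change a ≤ |B (u k) ω| - a
    linarith
  have hint : ∫ ω in A, S n ω ∂P ≤ (∫ x, x ^ 4 ∂gaussianReal 0 1) * (u n : ℝ) ^ 2 / a ^ 3 := by
    refine (setIntegral_le_integral (hS.integrable n) (.of_forall (hS0 n))).trans ?_
    rw [← hB.integral_pow_four, ← integral_div]
    refine integral_mono (hS.integrable n) ((hB.integrable_pow_four _).div_const _) fun ω => ?_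
    rw [hSap]
    exact max_abs_sub_zero_le_pow_four ha _
  have ha' : ENNReal.ofReal a ≠ 0 := by simpa using ha
  calc P _ ≤ P A := measure_mono hsub
    _ ≤ ENNReal.ofReal ((∫ x, x ^ 4 ∂gaussianReal 0 1) * (u n : ℝ) ^ 2 / a ^ 3) /
        ENNReal.ofReal a := by
      rw [ENNReal.le_div_iff_mul_le (.inl ha') (.inl ENNReal.ofReal_ne_top), mul_comm]
      exact key.trans (ENNReal.ofReal_le_ofReal hint)
    _ = _ := by
      rw [← ENNReal.ofReal_div_of_pos ha]
      congr 1
      field_simp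

/-- A maximal inequality for Brownian motion. -/
lemma IsBrownianReal.measure_exists_le (hB : IsBrownianReal B P) {a : ℝ} (ha : 0 < a)
    {t : ℝ≥0} (ht : 0 < t) :
    P {ω | ∃ s ≤ t, 4 * a ≤ |B s ω|} ≤
      ENNReal.ofReal ((∫ x, x ^ 4 ∂gaussianReal 0 1) * (t : ℝ) ^ 2 / a ^ 4) := by
  have hp := hB.toIsPreBrownianReal
  -- The natural filtration needs measurable variables. The versions `C` agree with `B` almost
  -- surely at all the countably many grid times.
  set C : ℝ≥0 → Ω → ℝ := fun t => (hp.aemeasurable t).mk (B t)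
  have hBC (t : ℝ≥0) : B t =ᵐ[P] C t := (hp.aemeasurable t).ae_eq_mk
  have hCm (t : ℝ≥0) : StronglyMeasurable (C t) :=
    (hp.aemeasurable t).measurable_mk.stronglyMeasurable
  have hC : IsPreBrownianReal C P := hp.congr hBC
  let u (n k : ℕ) : ℝ≥0 := k / 2 ^ n * t
  have hu (n : ℕ) : Monotone (u n) := fun i j hij => by dsimp only [u]; gcongr
  let A (n : ℕ) : Set Ω := {ω | ∃ k ≤ 2 ^ n, 2 * a ≤ |C (u n k) ω|}
  have hA (n : ℕ) : P (A n) ≤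
      ENNReal.ofReal ((∫ x, x ^ 4 ∂gaussianReal 0 1) * (t : ℝ) ^ 2 / a ^ 4) := by
    have := hC.measure_exists_grid_le hCm (hu n) ha (2 ^ n)
    simpa [u] using this
  have hmono : Monotone A := by
    refine monotone_nat_of_le_succ fun n => ?_
    rintro ω ⟨k, hk, h⟩
    refine ⟨2 * k, by rw [pow_succ]; omega, ?_⟩
    have : u (n + 1) (2 * k) = u n k := by
      simp only [u]; push_cast; rw [pow_succ]; field_simp
    rwa [this]
  have hall : ∀ᵐ ω ∂P, ∀ n k, B (u n k) ω = C (u n k) ω :=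
    ae_all_iff.2 fun n => ae_all_iff.2 fun k => hBC _
  calc P _ ≤ P (⋃ n, A n) := by
        refine measure_mono_ae ?_
        filter_upwards [hall, hB.cont] with ω h1 h2
        rintro ⟨s, hst, hs⟩
        -- Grid times approaching s from below, hence within [0, t]. By continuity |B| exceeds 2a at
        -- one of them; the gap between 4a and 2a makes this an open condition.
        let k (n : ℕ) : ℕ := ⌊(s / t : ℝ) * 2 ^ n⌋₊
        have hlim : Tendsto (fun n : ℕ => u n (k n)) atTop (𝓝 s) := by
          rw [← NNReal.tendsto_coe]
          have h := (tendsto_nat_floor_mul_div_atTop (R := ℝ) (a := s / t) (by positivity)).comp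
            (tendsto_pow_atTop_atTop_of_one_lt (r := (2 : ℝ)) one_lt_two)
          have h' := h.mul_const (t : ℝ)
          rw [div_mul_cancel₀ _ (NNReal.coe_ne_zero.2 ht.ne')] at h'
          exact h'
        obtain ⟨n, hn⟩ := (((h2.abs.tendsto s).comp hlim).eventually (lt_mem_nhds
          (show 2 * a < |B s ω| by linarith))).exists
        refine Set.mem_iUnion.2 ⟨n, k n, ?_, ?_⟩
        · refine Nat.floor_le_of_le ?_
          push_cast
          exact mul_le_of_le_one_left (by positivity) (div_le_one_of_le₀ hst t.coe_nonneg)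
        · rw [← h1]
          exact hn.le
    _ = ⨆ n, P (A n) := hmono.measure_iUnion
    _ ≤ _ := iSup_le hA

end ProbabilityTheory

/-! ### Second order Taylor remainder. -/

section Taylor

variable {E : Type*} [NormedAddCommGroup E] [NormedSpace ℝ E]

/-- The remainder of the second order Taylor expansion of `g` at `p`. -/
noncomputable def taylorRemainderTwo (g : E → ℝ) (p v : E) : ℝ :=
  g (p + v) - g p - fderiv ℝ g p v - 1 / 2 * fderiv ℝ (fderiv ℝ g) p v v

/-- By symmetry of D²g, the derivative of the remainder is the first order remainder of Dg, which is
o(‖v‖). The mean value inequality on the ball of radius ‖v‖ supplies the second factor ‖v‖. -/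
lemma exists_abs_taylorRemainderTwo_le {g : E → ℝ} (hg : ContDiff ℝ 2 g) (p : E) {ε : ℝ}
    (hε : 0 < ε) : ∃ δ > 0, ∀ v, ‖v‖ < δ → |taylorRemainderTwo g p v| ≤ ε * ‖v‖ ^ 2 := by
  have hd : Differentiable ℝ g := hg.differentiable (by simp)
  have hd2 : Differentiable ℝ (fderiv ℝ g) :=
    (hg.fderiv_right (m := 1) (by norm_num)).differentiable (by simp)
  have hsymm : IsSymmSndFDerivAt ℝ g p := hg.contDiffAt.isSymmSndFDerivAt (by simp)
  have hF (v : E) : HasFDerivAt (taylorRemainderTwo g p)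
      (fderiv ℝ g (p + v) - fderiv ℝ g p - fderiv ℝ (fderiv ℝ g) p v) v := by
    have h1 : HasFDerivAt (fun v => g (p + v)) (fderiv ℝ g (p + v)) v :=
      
      ((hd (p + v)).hasFDerivAt.comp v ((hasFDerivAt_id v).const_add p)).congr_fderiv (by
        ext; simp)
    have h2 := (fderiv ℝ g p).hasFDerivAt (x := v)
    have h3 : HasFDerivAt (fun v => fderiv ℝ (fderiv ℝ g) p v v)
        (fderiv ℝ (fderiv ℝ g) p v + (fderiv ℝ (fderiv ℝ g) p).flip v) v :=
      ((fderiv ℝ (fderiv ℝ g) p).hasFDerivAt.clm_apply (hasFDerivAt_id v)).congr_fderiv (by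
        ext; simp)
    have h4 := ((h1.sub_const (g p)).sub h2).sub (h3.const_mul (1 / 2))
    refine h4.congr_fderiv ?_
    ext w
    have := hsymm v w
    simp only [sub_apply, smul_apply,
      add_apply, ContinuousLinearMap.flip_apply, smul_eq_mul, ← this]
    ring
  have ho := (hd2 p).hasFDerivAt.isLittleO
  have h5 := (ho.def hε)
  rw [Metric.eventually_nhds_iff] at h5
  obtain ⟨δ, hδ, h⟩ := h5
  refine ⟨δ, hδ, fun v hv => ?_⟩
  have hmv := Convex.norm_image_sub_le_of_norm_fderiv_le (𝕜 := ℝ) (f := taylorRemainderTwo g p)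
    (C := ε * ‖v‖) (s := Metric.closedBall 0 ‖v‖) (x := 0) (y := v)
    (fun w _ => (hF w).differentiableAt) (fun w hw => ?_) (convex_closedBall _ _) (by simp)
    (by simp)
  · have h0 : taylorRemainderTwo g p 0 = 0 := by simp [taylorRemainderTwo]
    rw [h0, sub_zero, sub_zero, Real.norm_eq_abs] at hmv
    rwa [sq, ← mul_assoc]
  · rw [mem_closedBall_zero_iff] at hw
    rw [(hF w).fderiv]
    have := h (y := p + w) (by simpa using hw.trans_lt hv)
    simp only [add_sub_cancel_left] at this
    exact this.trans (by gcongr)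

lemma exists_abs_taylorRemainderTwo_le_of_bounded {g : E → ℝ} (hg : ContDiff ℝ 2 g) {M : ℝ}
    (hM : ∀ v, |g v| ≤ M) (p : E) {ε : ℝ} (hε : 0 < ε) :
    ∃ C, 0 ≤ C ∧ ∀ v, |taylorRemainderTwo g p v| ≤ ε * ‖v‖ ^ 2 + C * ‖v‖ ^ 4 := by
  obtain ⟨δ, hδ, h⟩ := exists_abs_taylorRemainderTwo_le hg p hε
  have hM0 : 0 ≤ M := (abs_nonneg _).trans (hM p)
  set a := ‖fderiv ℝ g p‖
  set b := ‖fderiv ℝ (fderiv ℝ g) p‖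
  -- Outside the δ-ball ‖v‖ / δ ≥ 1, so the terms of degree 0, 1 and 2 are raised to degree 4, whose
  -- expectation along B is O(t²).
  refine ⟨2 * M / δ ^ 4 + a / δ ^ 3 + b / δ ^ 2, by positivity, fun v => ?_⟩
  rcases lt_or_ge ‖v‖ δ with hv | hv
  · exact (h v hv).trans (le_add_of_nonneg_right (by positivity))
  have h1 : |fderiv ℝ g p v| ≤ a * ‖v‖ := (fderiv ℝ g p).le_opNorm v
  have h2 : |fderiv ℝ (fderiv ℝ g) p v v| ≤ b * ‖v‖ * ‖v‖ :=
    (fderiv ℝ (fderiv ℝ g) p).le_opNorm₂ v v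
  have h3 : |taylorRemainderTwo g p v| ≤ 2 * M + a * ‖v‖ + b * ‖v‖ ^ 2 := by
    have h4 := hM (p + v)
    have h5 := hM p
    have h6 : 0 ≤ b * ‖v‖ * ‖v‖ := by positivity
    rw [abs_le] at *
    unfold taylorRemainderTwo
    constructor <;> nlinarith
  have h7 : 1 ≤ ‖v‖ / δ := (one_le_div hδ).2 hv
  have e1 : 2 * M ≤ 2 * M * (‖v‖ / δ) ^ 4 :=
    le_mul_of_one_le_right (by positivity) (one_le_pow₀ h7)
  have e2 : a * ‖v‖ ≤ a * ‖v‖ * (‖v‖ / δ) ^ 3 :=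
    le_mul_of_one_le_right (by positivity) (one_le_pow₀ h7)
  have e3 : b * ‖v‖ ^ 2 ≤ b * ‖v‖ ^ 2 * (‖v‖ / δ) ^ 2 :=
    le_mul_of_one_le_right (by positivity) (one_le_pow₀ h7)
  have e4 : 2 * M * (‖v‖ / δ) ^ 4 + a * ‖v‖ * (‖v‖ / δ) ^ 3 + b * ‖v‖ ^ 2 * (‖v‖ / δ) ^ 2 =
      (2 * M / δ ^ 4 + a / δ ^ 3 + b / δ ^ 2) * ‖v‖ ^ 4 := by
    field_simp
  have : 0 ≤ ε * ‖v‖ ^ 2 := by positivity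
  linarith

end Taylor

/-! ### Moments and generator of Brownian motion on ℝ^d. -/

namespace IsBrownianEuc

variable {d : ℕ} {Ω : Type*} [MeasurableSpace Ω] {P : Measure Ω} {B : ℝ≥0 → Ω → Euc d}

lemma aemeasurable (hB : IsBrownianEuc B P) (t : ℝ≥0) : AEMeasurable (B t) P := by
  have h : AEMeasurable (fun ω => WithLp.ofLp (B t ω)) P :=
    aemeasurable_pi_lambda _ fun i => (hB.isBrownianReal i).aemeasurable t
  exact (WithLp.measurable_toLp 2 (Fin d → ℝ)).comp_aemeasurable h

lemma ae_continuous (hB : IsBrownianEuc B P) : ∀ᵐ ω ∂P, Continuous (B · ω) := by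
  filter_upwards [ae_all_iff.2 fun i => (hB.isBrownianReal i).cont] with ω h
  have : Continuous fun t i => B t ω i := continuous_pi h
  exact (PiLp.continuous_toLp 2 _).comp this

lemma ae_eval_zero (hB : IsBrownianEuc B P) : ∀ᵐ ω ∂P, B 0 ω = 0 := by
  filter_upwards [ae_all_iff.2 fun i => (hB.isBrownianReal i).eval_zero_ae_eq_zero] with ω h
  ext i
  exact h i

lemma integrable_mul (hB : IsBrownianEuc B P) (t : ℝ≥0) (i j : Fin d) :
    Integrable (fun ω => B t ω i * B t ω j) P :=
  ((hB.isBrownianReal i).memLp_two_eval t).integrable_mul ((hB.isBrownianReal j).memLp_two_eval t)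

lemma integral_mul (hB : IsBrownianEuc B P) (t : ℝ≥0) (i j : Fin d) :
    ∫ ω, B t ω i * B t ω j ∂P = if i = j then (t : ℝ) else 0 := by
  split_ifs with h
  · subst h
    rw [← (hB.isBrownianReal i).integral_sq t]
    simp only [sq]
  · have h1 := (hB.iIndepFun_coord.indepFun h).comp
      (show Measurable fun x : ℝ≥0 → ℝ => x t from measurable_pi_apply t)
      (show Measurable fun x : ℝ≥0 → ℝ => x t from measurable_pi_apply t)
    have h2 := h1.integral_mul_eq_mul_integral
      ((hB.isBrownianReal i).aemeasurable t).aestronglyMeasurable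
      ((hB.isBrownianReal j).aemeasurable t).aestronglyMeasurable
    have h3 := (hB.isBrownianReal i).integral_eval t
    calc _ = (∫ ω, B t ω i ∂P) * ∫ ω, B t ω j ∂P := h2
      _ = 0 := by rw [h3, zero_mul]

lemma integrable_clm (hB : IsBrownianEuc B P) (L : Euc d →L[ℝ] ℝ) (t : ℝ≥0) :
    Integrable (fun ω => L (B t ω)) P ∧ ∫ ω, L (B t ω) ∂P = 0 := by
  have hL (v : Euc d) : L v = ∑ i, v i * L (EuclideanSpace.single i 1) := by
    conv_lhs => rw [← (EuclideanSpace.basisFun (Fin d) ℝ).sum_repr v]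
    simp
  have hi (i : Fin d) : Integrable (fun ω => B t ω i * L (EuclideanSpace.single i 1)) P :=
    ((hB.isBrownianReal i).integrable_eval t).mul_const _
  simp_rw [hL (B t _)]
  refine ⟨integrable_finsetSum _ fun i _ => hi i, ?_⟩
  rw [integral_finsetSum _ fun i _ => hi i]
  refine Finset.sum_eq_zero fun i _ => ?_
  rw [integral_mul_const, (hB.isBrownianReal i).integral_eval t, zero_mul]

lemma integrable_bilin (hB : IsBrownianEuc B P) (H : Euc d →L[ℝ] Euc d →L[ℝ] ℝ) (t : ℝ≥0) :
    Integrable (fun ω => H (B t ω) (B t ω)) P ∧ ∫ ω, H (B t ω) (B t ω) ∂P =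
      t * ∑ i, H (EuclideanSpace.single i 1) (EuclideanSpace.single i 1) := by
  have hH (v : Euc d) : H v v =
      ∑ i, ∑ j, v i * v j * H (EuclideanSpace.single i 1) (EuclideanSpace.single j 1) := by
    conv_lhs => rw [← (EuclideanSpace.basisFun (Fin d) ℝ).sum_repr v]
    simp only [EuclideanSpace.basisFun_repr, EuclideanSpace.basisFun_apply, map_sum, map_smul,
      sum_apply, smul_apply, smul_eq_mul, Finset.mul_sum]
    rw [Finset.sum_comm]
    exact Finset.sum_congr rfl fun i _ => Finset.sum_congr rfl fun j _ => by ring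
  have hi (i j : Fin d) : Integrable (fun ω => B t ω i * B t ω j *
      H (EuclideanSpace.single i 1) (EuclideanSpace.single j 1)) P :=
    (hB.integrable_mul t i j).mul_const _
  simp_rw [hH (B t _)]
  refine ⟨integrable_finsetSum _ fun i _ => integrable_finsetSum _ fun j _ => hi i j, ?_⟩
  rw [integral_finsetSum _ fun i _ => integrable_finsetSum _ fun j _ => hi i j, Finset.mul_sum]
  refine Finset.sum_congr rfl fun i _ => ?_
  rw [integral_finsetSum _ fun j _ => hi i j]
  simp_rw [integral_mul_const, hB.integral_mul t]
  simp

lemma norm_pow_four_le (v : Euc d) : ‖v‖ ^ 4 ≤ d * ∑ i, v i ^ 4 := by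
  have h : ‖v‖ ^ 4 = (∑ i, v i ^ 2) ^ 2 := by
    rw [← EuclideanSpace.real_norm_sq_eq]; ring
  have h2 := sq_sum_le_card_mul_sum_sq (s := Finset.univ) (f := fun i => v i ^ 2)
  rw [h]
  simpa [← pow_mul] using h2

lemma integrable_norm_sq (hB : IsBrownianEuc B P) (t : ℝ≥0) :
    Integrable (fun ω => ‖B t ω‖ ^ 2) P ∧ ∫ ω, ‖B t ω‖ ^ 2 ∂P = d * t := by
  simp only [EuclideanSpace.real_norm_sq_eq]
  have hi (i : Fin d) : Integrable (fun ω => B t ω i ^ 2) P := by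
    simpa only [sq] using hB.integrable_mul t i i
  refine ⟨integrable_finsetSum _ fun i _ => hi i, ?_⟩
  rw [integral_finsetSum _ fun i _ => hi i]
  simp_rw [fun i => (hB.isBrownianReal i).integral_sq t]
  simp

lemma integrable_norm_pow_four (hB : IsBrownianEuc B P) (t : ℝ≥0) :
    Integrable (fun ω => ‖B t ω‖ ^ 4) P ∧ ∫ ω, ‖B t ω‖ ^ 4 ∂P ≤
      d ^ 2 * (∫ x, x ^ 4 ∂gaussianReal 0 1) * (t : ℝ) ^ 2 := by
  have hi : Integrable (fun ω => (d : ℝ) * ∑ i, B t ω i ^ 4) P :=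
    (integrable_finsetSum _ fun i _ => (hB.isBrownianReal i).integrable_pow_four t).const_mul _
  have hint : Integrable (fun ω => ‖B t ω‖ ^ 4) P := by
    refine hi.mono' ((hB.aemeasurable t).norm.pow_const 4).aestronglyMeasurable
      (.of_forall fun ω => ?_)
    rw [Real.norm_of_nonneg (by positivity)]
    exact norm_pow_four_le _
  refine ⟨hint, (integral_mono hint hi fun ω => norm_pow_four_le _).trans_eq ?_⟩
  rw [integral_const_mul, integral_finsetSum _ fun i _ =>
    (hB.isBrownianReal i).integrable_pow_four t]
  simp_rw [fun i => (hB.isBrownianReal i).integral_pow_four t]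
  simp
  ring

/-- The generator of Brownian motion is half the Laplacian on bounded `C^2` functions. -/
lemma tendsto_generator [IsProbabilityMeasure P] (hB : IsBrownianEuc B P) {g : Euc d → ℝ}
    (hg : ContDiff ℝ 2 g) {M : ℝ} (hM : ∀ v, |g v| ≤ M) :
    Tendsto (fun t : ℝ≥0 => ((∫ ω, g (B t ω) ∂P) - g 0) / (t : ℝ)) (𝓝[>] 0)
      (𝓝 (1 / 2 * ∑ i, fderiv ℝ (fderiv ℝ g) 0 (EuclideanSpace.single i 1)
        (EuclideanSpace.single i 1))) := by
  set D := fderiv ℝ g 0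
  set H := fderiv ℝ (fderiv ℝ g) 0
  set S := ∑ i, H (EuclideanSpace.single i 1) (EuclideanSpace.single i 1)
  set K := ∫ x, x ^ 4 ∂gaussianReal 0 1
  have hK : 0 ≤ K := integral_nonneg fun x => by positivity
  have hgint (t : ℝ≥0) : Integrable (fun ω => g (B t ω)) P :=
    Integrable.of_bound (hg.continuous.measurable.comp_aemeasurable
      (hB.aemeasurable t)).aestronglyMeasurable M (.of_forall fun ω => hM _)
  have hrem (t : ℝ≥0) : Integrable (fun ω => taylorRemainderTwo g 0 (B t ω)) P ∧
      ∫ ω, taylorRemainderTwo g 0 (B t ω) ∂P = (∫ ω, g (B t ω) ∂P) - g 0 - 1 / 2 * (t * S) := by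
    obtain ⟨h1, h2⟩ := hB.integrable_clm D t
    obtain ⟨h3, h4⟩ := hB.integrable_bilin H t
    have h5 : Integrable (fun ω => g (B t ω) - g 0) P := (hgint t).sub (integrable_const _)
    have h6 : Integrable (fun ω => g (B t ω) - g 0 - D (B t ω)) P := h5.sub h1
    have h7 : Integrable (fun ω => 1 / 2 * H (B t ω) (B t ω)) P := h3.const_mul _
    simp only [taylorRemainderTwo, zero_add]
    refine ⟨h6.sub h7, ?_⟩
    rw [integral_sub h6 h7, integral_sub h5 h1, integral_sub (hgint t) (integrable_const _),
      integral_const_mul, h2, h4]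
    simp [S]
  rw [Metric.tendsto_nhds]
  intro ε hε
  -- As E‖B_t‖² = d t, the quadratic term contributes at most ε t / 2; the `+ 1` covers d = 0.
  obtain ⟨C, hC, hbound⟩ := exists_abs_taylorRemainderTwo_le_of_bounded hg hM 0
    (ε := ε / (2 * (d + 1))) (by positivity)
  have hlim : Tendsto (fun t : ℝ≥0 => C * (d ^ 2 * K) * (t : ℝ)) (𝓝[>] 0) (𝓝 0) := by
    have : Continuous fun t : ℝ≥0 => C * (d ^ 2 * K) * (t : ℝ) := by fun_prop
    exact (this.tendsto' 0 0 (by simp)).mono_left nhdsWithin_le_nhds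
  filter_upwards [hlim.eventually (gt_mem_nhds (half_pos hε)), self_mem_nhdsWithin] with t ht ht0
  have ht0 : (0 : ℝ) < t := NNReal.coe_pos.2 ht0
  obtain ⟨hi, he⟩ := hrem t
  obtain ⟨h2, h2'⟩ := hB.integrable_norm_sq t
  obtain ⟨h4, h4'⟩ := hB.integrable_norm_pow_four t
  have hle : |∫ ω, taylorRemainderTwo g 0 (B t ω) ∂P| ≤
      ε / (2 * (d + 1)) * (d * t) + C * (d ^ 2 * K * (t : ℝ) ^ 2) := by
    calc _ ≤ ∫ ω, |taylorRemainderTwo g 0 (B t ω)| ∂P := abs_integral_le_integral_abs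
      _ ≤ ∫ ω, (ε / (2 * (d + 1)) * ‖B t ω‖ ^ 2 + C * ‖B t ω‖ ^ 4) ∂P :=
        integral_mono hi.abs ((h2.const_mul _).add (h4.const_mul _)) fun ω => hbound _
      _ ≤ _ := by
        rw [integral_add (h2.const_mul _) (h4.const_mul _), integral_const_mul,
          integral_const_mul, h2']
        gcongr
  have heq : ((∫ ω, g (B t ω) ∂P) - g 0) / (t : ℝ) - 1 / 2 * S =
      (∫ ω, taylorRemainderTwo g 0 (B t ω) ∂P) / t := by
    rw [he]; field_simp
  have h5 : ε / (2 * (d + 1)) * d ≤ ε / 2 := by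
    rw [div_mul_eq_mul_div, div_le_div_iff₀ (by positivity) two_pos]
    nlinarith
  rw [Real.dist_eq, heq, abs_div, abs_of_pos ht0, div_lt_iff₀ ht0]
  nlinarith

end IsBrownianEuc

/-! ### Second derivatives, and the algebra of the reflection. -/

lemma lineDeriv_lineDeriv_eq_fderiv_fderiv {E : Type*} [NormedAddCommGroup E] [NormedSpace ℝ E]
    {f : E → ℝ} (hf : ContDiff ℝ 2 f) (p u v : E) :
    lineDeriv ℝ (fun q => lineDeriv ℝ f q v) p u = fderiv ℝ (fderiv ℝ f) p u v := by
  have hd : Differentiable ℝ f := hf.differentiable (by simp)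
  have hd2 : Differentiable ℝ (fderiv ℝ f) :=
    (hf.fderiv_right (m := 1) (by norm_num)).differentiable (by simp)
  have h : (fun q => lineDeriv ℝ f q v) = fun q => fderiv ℝ f q v :=
    funext fun q => (hd q).lineDeriv_eq_fderiv
  have h2 := (hd2 p).hasFDerivAt.clm_apply (hasFDerivAt_const v p)
  rw [h, h2.differentiableAt.lineDeriv_eq_fderiv, h2.fderiv]
  simp

lemma fderiv_fderiv_comp_add_clm {E F : Type*} [NormedAddCommGroup E] [NormedSpace ℝ E]
    [NormedAddCommGroup F] [NormedSpace ℝ F] {f : F → ℝ} (hf : ContDiff ℝ 2 f) (p : F)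
    (L : E →L[ℝ] F) (u v : E) :
    fderiv ℝ (fderiv ℝ fun w => f (p + L w)) 0 u v = fderiv ℝ (fderiv ℝ f) p (L u) (L v) := by
  have h := L.iteratedFDeriv_comp_right (f := fun q => f (p + q))
    (hf.comp (contDiff_const.add contDiff_id)) 0 (i := 2) le_rfl
  rw [iteratedFDeriv_comp_add_left] at h
  have h2 := congr($h ![u, v])
  simpa [iteratedFDeriv_two_apply, Function.comp_def] using h2

section Reflection

variable {d : ℕ}

/-- The linear part of the reflection `mirrorReflect x y`. -/
noncomputable def mirrorReflectLin (x y : Euc d) : Euc d ≃ₗᵢ[ℝ] Euc d :=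
  (ℝ ∙ (x - y))ᗮ.reflection

/-- For x = y the orthogonal complement is the whole space and the reflection is the identity, in
agreement with 0 / 0 = 0. -/
lemma mirrorReflectLin_apply (x y v : Euc d) :
    mirrorReflectLin x y v = v - (2 * inner ℝ v (x - y) / ‖x - y‖ ^ 2) • (x - y) := by
  rw [mirrorReflectLin, Submodule.reflection_orthogonal_apply,
    Submodule.reflection_singleton_apply, neg_sub, two_smul, ← add_smul, real_inner_comm]
  congr 2
  simp
  ring

lemma mirrorReflect_add (x y v : Euc d) :
    mirrorReflect x y (x + v) = y + mirrorReflectLin x y v := by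
  rw [mirrorReflectLin_apply, mirrorReflect]
  rcases eq_or_ne x y with rfl | h
  · simp
  have h0 : ‖x - y‖ ^ 2 ≠ 0 := pow_ne_zero 2 (norm_ne_zero_iff.2 (sub_ne_zero.2 h))
  have h1 : x + v - (2⁻¹ : ℝ) • (x + y) = (2⁻¹ : ℝ) • (x - y) + v := by module
  rw [h1, inner_add_left, real_inner_smul_left, real_inner_self_eq_norm_sq]
  have h2 : 2 * (2⁻¹ * ‖x - y‖ ^ 2 + inner ℝ v (x - y)) / ‖x - y‖ ^ 2 =
      1 + 2 * inner ℝ v (x - y) / ‖x - y‖ ^ 2 := by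
    rw [eq_comm, ← div_self h0, ← add_div]
    congr 1
    ring
  rw [h2]
  module

/-- The linear map `v ↦ (v, R v)`, where `R` is the linear part of the reflection on
`mirror x y`. -/
noncomputable def mirrorPair (x y : Euc d) : Euc d →L[ℝ] EucPair d :=
  (WithLp.prodContinuousLinearEquiv 2 ℝ (Euc d) (Euc d)).symm.toContinuousLinearMap ∘L
    (ContinuousLinearMap.id ℝ (Euc d)).prod
      (mirrorReflectLin x y).toContinuousLinearEquiv.toContinuousLinearMap

lemma mirrorPair_apply (x y v : Euc d) :
    mirrorPair x y v = WithLp.toLp 2 (v, mirrorReflectLin x y v) := rfl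

lemma toLp_mirrorReflect_eq (p : EucPair d) (v : Euc d) :
    WithLp.toLp 2 (p.fst + v, mirrorReflect p.fst p.snd (p.fst + v)) =
      p + mirrorPair p.fst p.snd v := by
  rw [mirrorReflect_add, mirrorPair_apply]
  rfl

lemma partialFst_partialSnd {f : EucPair d → ℝ} (hf : ContDiff ℝ 2 f) (p : EucPair d)
    (i k : Fin d) :
    partialFst i (partialSnd k f) p = fderiv ℝ (fderiv ℝ f) p
      (WithLp.toLp 2 (EuclideanSpace.single i 1, 0))
      (WithLp.toLp 2 (0, EuclideanSpace.single k 1)) :=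
  lineDeriv_lineDeriv_eq_fderiv_fderiv hf p _ _

lemma reflectionGenerator_eq {f : EucPair d → ℝ} (hf : ContDiff ℝ 2 f) (p : EucPair d) :
    reflectionGenerator f p = 1 / 2 * ∑ i, fderiv ℝ (fderiv ℝ f) p
      (mirrorPair p.fst p.snd (EuclideanSpace.single i 1))
      (mirrorPair p.fst p.snd (EuclideanSpace.single i 1)) := by
  set H := fderiv ℝ (fderiv ℝ f) p with hH
  have hsymm : IsSymmSndFDerivAt ℝ f p := hf.contDiffAt.isSymmSndFDerivAt (by simp)
  set R := mirrorReflectLin p.fst p.snd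
  let a (i : Fin d) : EucPair d := WithLp.toLp 2 (EuclideanSpace.single i 1, 0)
  let b (k : Fin d) : EucPair d := WithLp.toLp 2 (0, EuclideanSpace.single k 1)
  let c (i : Fin d) : EucPair d := WithLp.toLp 2 (0, R (EuclideanSpace.single i 1))
  have hL (i : Fin d) : mirrorPair p.fst p.snd (EuclideanSpace.single i 1) = a i + c i := by
    rw [mirrorPair_apply, ← WithLp.toLp_add]
    simp [R]
  have hlap : Laplacian.laplacian f p = ∑ i, H (a i) (a i) + ∑ i, H (c i) (c i) := by
    -- The Laplacian may be computed in any orthonormal basis; rotating the second factor by `R`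
    -- makes the diagonal terms `H (c i) (c i)` appear.
    rw [InnerProductSpace.laplacian_eq_iteratedFDeriv_orthonormalBasis f
      ((EuclideanSpace.basisFun (Fin d) ℝ).prod ((EuclideanSpace.basisFun (Fin d) ℝ).map R))]
    simp [iteratedFDeriv_two_apply, a, c, hH]
  have hc (i : Fin d) : c i = ∑ k, ((if i = k then (1 : ℝ) else 0) -
      2 * ((p.fst i - p.snd i) * (p.fst k - p.snd k) / ‖p.fst - p.snd‖ ^ 2)) • b k := by
    have h1 : R (EuclideanSpace.single i 1) = ∑ k, ((if i = k then (1 : ℝ) else 0) -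
        2 * ((p.fst i - p.snd i) * (p.fst k - p.snd k) / ‖p.fst - p.snd‖ ^ 2)) •
          EuclideanSpace.single k (1 : ℝ) := by
      rw [← (EuclideanSpace.basisFun (Fin d) ℝ).sum_repr (R (EuclideanSpace.single i 1))]
      refine Finset.sum_congr rfl fun k _ => ?_
      simp only [R, EuclideanSpace.basisFun_repr, EuclideanSpace.basisFun_apply,
        mirrorReflectLin_apply]
      congr 1
      simp [PiLp.single_apply, eq_comm (a := k), EuclideanSpace.inner_single_left]
      ring
    let ι : Euc d →ₗ[ℝ] EucPair d :=
      (WithLp.linearEquiv 2 ℝ (Euc d × Euc d)).symm.toLinearMap ∘ₗ LinearMap.inr ℝ (Euc d) (Euc d)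
    change ι (R (EuclideanSpace.single i 1)) = ∑ k, _ • ι (EuclideanSpace.single k 1)
    rw [h1, map_sum]
    simp only [map_smul]
  have hmix : ∑ i, H (a i) (c i) = ∑ i, ∑ k, ((if i = k then (1 : ℝ) else 0) -
      2 * ((p.fst i - p.snd i) * (p.fst k - p.snd k) / ‖p.fst - p.snd‖ ^ 2)) *
        partialFst i (partialSnd k f) p := by
    refine Finset.sum_congr rfl fun i _ => ?_
    rw [hc, map_sum]
    refine Finset.sum_congr rfl fun k _ => ?_
    rw [partialFst_partialSnd hf, map_smul, smul_eq_mul]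
  rw [reflectionGenerator, ← hmix, hlap]
  simp only [hL, map_add, add_apply, Finset.sum_add_distrib]
  have : ∑ i, H (c i) (a i) = ∑ i, H (a i) (c i) := Finset.sum_congr rfl fun i _ => hsymm _ _
  rw [this]
  ring

end Reflection

/-! ### Hitting the mirror along a path. -/

section HitTime

variable {d : ℕ} {x y : Euc d} {X : ℝ≥0 → Euc d}

lemma hitTime_mirror_self (x : Euc d) (X : ℝ≥0 → Euc d) : hitTime (mirror x x) X = 0 := by
  refine le_antisymm (ENNReal.le_of_forall_pos_le_add fun ε hε _ => ?_) zero_le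
  rw [zero_add]
  exact iInf₂_le ε ⟨hε, rfl⟩

lemma norm_sub_le_of_mem_mirror {v : Euc d} (h : x + v ∈ mirror x y) : ‖x - y‖ ≤ 2 * ‖v‖ := by
  have h1 : ‖x - (x + v)‖ = ‖y - (x + v)‖ := h
  have h2 : x - (x + v) = -v := by abel
  rw [h2, norm_neg] at h1
  calc ‖x - y‖ = ‖-v - (y - (x + v))‖ := by congr 1; abel
    _ ≤ ‖-v‖ + ‖y - (x + v)‖ := norm_sub_le _ _
    _ = 2 * ‖v‖ := by rw [← h1, norm_neg]; ring

/-- A continuous path that starts outside the closed set `mirror x y` has not hit it up to time `t`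
if and only if it stays at a positive distance on a dense set of times. -/
lemma lt_hitTime_mirror_iff (hX : Continuous X) (h0 : X 0 ∉ mirror x y) (t : ℝ≥0) :
    (t : ℝ≥0∞) < hitTime (mirror x y) X ↔ ∃ n : ℕ, ∀ k : ℕ,
      1 / ((n : ℝ) + 1) ≤ |‖x - X (TopologicalSpace.denseSeq (Set.Iic t) k)‖ -
        ‖y - X (TopologicalSpace.denseSeq (Set.Iic t) k)‖| := by
  let φ (s : ℝ≥0) : ℝ := |‖x - X s‖ - ‖y - X s‖|
  have hφ : Continuous φ := by fun_prop
  have hφ0 (s : ℝ≥0) : X s ∈ mirror x y ↔ φ s = 0 := by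
    simp [φ, mirror, sub_eq_zero]
  have hφnn (s : ℝ≥0) : 0 ≤ φ s := abs_nonneg _
  constructor
  · intro h
    have hpos (s : ℝ≥0) (hs : s ≤ t) : 0 < φ s := by
      refine (hφnn s).lt_of_ne fun h1 => ?_
      have hmem : X s ∈ mirror x y := (hφ0 s).2 h1.symm
      -- The infimum runs over s > 0 only, so time 0 is excluded by `h0` instead.
      rcases eq_or_ne s 0 with rfl | hs0
      · exact h0 hmem
      · have : hitTime (mirror x y) X ≤ s := iInf₂_le s ⟨pos_of_ne_zero hs0, hmem⟩
        exact absurd (h.trans_le this) (by simpa using hs)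
    obtain ⟨s, hs, hmin⟩ := (isCompact_Icc (a := 0) (b := t)).exists_isMinOn
      (Set.nonempty_Icc.2 zero_le) hφ.continuousOn
    obtain ⟨n, hn⟩ := exists_nat_one_div_lt (hpos s hs.2)
    refine ⟨n, fun k => hn.le.trans (hmin ⟨zero_le, ?_⟩)⟩
    exact (TopologicalSpace.denseSeq (Set.Iic t) k).2
  · rintro ⟨n, hn⟩
    have hc : (0 : ℝ) < 1 / ((n : ℝ) + 1) := by positivity
    have hall (s : Set.Iic t) : 1 / ((n : ℝ) + 1) ≤ φ s :=
      (TopologicalSpace.denseRange_denseSeq (Set.Iic t)).induction_on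
        (p := fun s : Set.Iic t => 1 / ((n : ℝ) + 1) ≤ φ s) s
        (isClosed_le continuous_const (hφ.comp continuous_subtype_val)) hn
    -- No hit up to t only gives τ ≥ t. Positivity of `φ` persists on some [t, u), whence τ ≥ u > t.
    have hev : ∀ᶠ s in 𝓝 t, 0 < φ s :=
      (hφ.tendsto t).eventually (lt_mem_nhds (hc.trans_le (hall ⟨t, Set.mem_Iic.2 le_rfl⟩)))
    obtain ⟨u, htu, hu⟩ := mem_nhdsGE_iff_exists_Ico_subset.1 (mem_nhdsWithin_of_mem_nhds hev)
    refine (ENNReal.coe_lt_coe.2 htu).trans_le (le_iInf₂ fun s hs => ?_)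
    by_contra! hsu
    have hsu : s < u := ENNReal.coe_lt_coe.1 hsu
    have h1 := (hφ0 s).1 hs.2
    rcases le_total s t with h2 | h2
    · exact (hc.trans_le (hall ⟨s, h2⟩)).ne' h1
    · exact (hu ⟨h2, hsu⟩ : 0 < φ s).ne' h1

end HitTime

/-! ### Measurability and probability of hitting the mirror. -/

namespace IsBrownianEuc

variable {d : ℕ} {Ω : Type*} [MeasurableSpace Ω] {P : Measure Ω} {B : ℝ≥0 → Ω → Euc d}

lemma exists_measure_exists_le_norm_le (hB : IsBrownianEuc B P) {r : ℝ} (hr : 0 < r) :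
    ∃ C : ℝ, ∀ t : ℝ≥0, 0 < t →
      P {ω | ∃ s ≤ t, r ≤ ‖B s ω‖} ≤ ENNReal.ofReal (C * (t : ℝ) ^ 2) := by
  set K := ∫ x, x ^ 4 ∂gaussianReal 0 1
  have hK : 0 ≤ K := integral_nonneg fun x => by positivity
  -- If all coordinates stay below 4a, then ‖B‖ ≤ 4ad, which this choice makes strictly less than r.
  set a := r / (4 * (d + 1)) with ha_def
  have ha : 0 < a := by positivity
  have har : d * (4 * a) < r := by
    have : (d + 1 : ℝ) * (4 * a) = r := by rw [ha_def]; field_simp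
    nlinarith
  refine ⟨d * (K / a ^ 4), fun t ht => ?_⟩
  calc P _ ≤ P (⋃ i : Fin d, {ω | ∃ s ≤ t, 4 * a ≤ |B s ω i|}) := by
        refine measure_mono fun ω => ?_
        rintro ⟨s, hs, h⟩
        by_contra hcon
        simp only [Set.mem_iUnion, Set.mem_ofPred_eq, not_exists, not_and, not_le] at hcon
        refine absurd (h.trans ?_) (not_le.2 har)
        rw [← (EuclideanSpace.basisFun (Fin d) ℝ).sum_repr (B s ω)]
        refine (norm_sum_le_of_le (Finset.univ) (f := _) (n := fun _ => 4 * a)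
          fun i _ => ?_).trans_eq (by simp)
        simpa [norm_smul] using (hcon i s hs).le
    _ ≤ ∑ i : Fin d, P {ω | ∃ s ≤ t, 4 * a ≤ |B s ω i|} := measure_iUnion_fintype_le _ _
    _ ≤ ∑ i : Fin d, ENNReal.ofReal (K * (t : ℝ) ^ 2 / a ^ 4) :=
        Finset.sum_le_sum fun i _ => (hB.isBrownianReal i).measure_exists_le ha ht
    _ = _ := by
        rw [← ENNReal.ofReal_sum_of_nonneg fun i _ => by positivity]
        congr 1
        simp
        ring

/-- For almost every path, continuous with B_0 = 0, the event is described by countably many times.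
-/
lemma nullMeasurableSet_lt_hitTime (hB : IsBrownianEuc B P) {x y : Euc d} (hxy : x ≠ y)
    (t : ℝ≥0) :
    NullMeasurableSet {ω | (t : ℝ≥0∞) < hitTime (mirror x y) fun s => x + B s ω} P := by
  let q (k : ℕ) : ℝ≥0 := TopologicalSpace.denseSeq (Set.Iic t) k
  have hm : NullMeasurableSet (⋃ n : ℕ, ⋂ k : ℕ, {ω | 1 / ((n : ℝ) + 1) ≤
      |‖x - (x + B (q k) ω)‖ - ‖y - (x + B (q k) ω)‖|}) P := by
    refine .iUnion fun n => .iInter fun k => nullMeasurableSet_le aemeasurable_const ?_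
    have := hB.aemeasurable (q k)
    fun_prop
  refine hm.congr (eventuallyEq_set.2 ?_)
  filter_upwards [hB.ae_continuous, hB.ae_eval_zero] with ω h1 h2
  have h0 : x + B 0 ω ∉ mirror x y := by
    intro h
    have := norm_sub_le_of_mem_mirror h
    rw [h2, norm_zero, mul_zero] at this
    exact hxy (sub_eq_zero.1 (norm_le_zero_iff.1 this))
  refine Iff.trans ?_ ((lt_hitTime_mirror_iff (X := fun s => x + B s ω)
    (by fun_prop) h0 t).symm.trans Set.mem_ofPred.symm)
  simp only [Set.mem_iUnion, Set.mem_iInter, Set.mem_ofPred_eq, q]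

/-- The hitting time of the mirror is at most `t` with probability `O(t^2)`. -/
lemma exists_measure_hitTime_le_le (hB : IsBrownianEuc B P) {x y : Euc d} (hxy : x ≠ y) :
    ∃ C : ℝ, ∀ t : ℝ≥0, 0 < t →
      P {ω | (t : ℝ≥0∞) < hitTime (mirror x y) fun s => x + B s ω}ᶜ ≤
        ENNReal.ofReal (C * (t : ℝ) ^ 2) := by
  have hr : 0 < ‖x - y‖ / 2 := half_pos (norm_pos_iff.2 (sub_ne_zero.2 hxy))
  obtain ⟨C, hC⟩ := hB.exists_measure_exists_le_norm_le hr
  refine ⟨C * 4, fun t ht => ?_⟩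
  -- From τ ≤ t < 2t one gets an actual hit before 2t, so the infimum need not be attained; hence
  -- the factor 4.
  have h2 := hC (2 * t) (by positivity)
  have heq : C * ((2 * t : ℝ≥0) : ℝ) ^ 2 = C * 4 * (t : ℝ) ^ 2 := by push_cast; ring
  rw [heq] at h2
  refine (measure_mono fun ω hω => ?_).trans h2
  have hlt : hitTime (mirror x y) (fun s => x + B s ω) < ((2 * t : ℝ≥0) : ℝ≥0∞) :=
    (not_lt.1 fun h => hω h).trans_lt (ENNReal.coe_lt_coe.2 (lt_mul_of_one_lt_left ht one_lt_two))
  obtain ⟨s, hs⟩ := iInf_lt_iff.1 hlt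
  obtain ⟨hs', hst⟩ := iInf_lt_iff.1 hs
  refine ⟨s, (ENNReal.coe_lt_coe.1 hst).le, ?_⟩
  have := norm_sub_le_of_mem_mirror hs'.2
  linarith

end IsBrownianEuc

/-! ### The coupling and its generator. -/

section Coupling

variable {d : ℕ} {Ω : Type*} {B : ℝ≥0 → Ω → Euc d}

lemma reflectionCoupling_of_lt_hitTime {p : EucPair d} {t : ℝ≥0} {ω : Ω}
    (h : (t : ℝ≥0∞) < hitTime (mirror p.fst p.snd) fun s => p.fst + B s ω) :
    reflectionCoupling B p t ω = p + mirrorPair p.fst p.snd (B t ω) := by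
  rw [reflectionCoupling, reflectUntilHit, if_pos h, toLp_mirrorReflect_eq]

lemma reflectionCoupling_of_not_lt_hitTime {p : EucPair d} {t : ℝ≥0} {ω : Ω}
    (h : ¬ (t : ℝ≥0∞) < hitTime (mirror p.fst p.snd) fun s => p.fst + B s ω) :
    reflectionCoupling B p t ω = WithLp.toLp 2 (p.fst + B t ω, p.fst + B t ω) := by
  rw [reflectionCoupling, reflectUntilHit, if_neg h]

/-- On the diagonal τ = 0 and the reflection is the identity, so the formula valid before τ holds at
all times. -/
lemma reflectionCoupling_of_fst_eq_snd {p : EucPair d} (hp : p.fst = p.snd) (t : ℝ≥0) (ω : Ω) :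
    reflectionCoupling B p t ω = p + mirrorPair p.fst p.snd (B t ω) := by
  rw [reflectionCoupling_of_not_lt_hitTime (by simp [hp, hitTime_mirror_self]),
    ← toLp_mirrorReflect_eq, mirrorReflect]
  simp [hp]

end Coupling

theorem theorem5p6 (d : ℕ) {Ω : Type*} [MeasurableSpace Ω] (P : Measure Ω) [IsProbabilityMeasure P]
    (B : ℝ≥0 → Ω → Euc d) (hB : IsBrownianEuc B P)
    (f : C₀(EucPair d, ℝ)) (hf : ContDiff ℝ 2 f) :
    HasExtendedPointwiseGenerator (reflectionCoupling B) P f (reflectionGenerator f) := by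
  intro p
  obtain ⟨M, hM⟩ : ∃ M, ∀ q, |f q| ≤ M := by
    obtain ⟨M, hM⟩ := isBounded_iff_forall_norm_le.1 f.isBounded_range
    exact ⟨M, fun q => hM _ ⟨q, rfl⟩⟩
  set L := mirrorPair p.fst p.snd
  have hg : ContDiff ℝ 2 fun v => f (p + L v) :=
    hf.comp (contDiff_const.add L.contDiff)
  have hlim := hB.tendsto_generator hg fun v => hM _
  simp only [fderiv_fderiv_comp_add_clm hf, map_zero, add_zero] at hlim
  rw [← reflectionGenerator_eq hf] at hlim
  have hint {h : Euc d → ℝ} (hc : Continuous h) (hb : ∀ v, |h v| ≤ M) (t : ℝ≥0) :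
      Integrable (fun ω => h (B t ω)) P :=
    Integrable.of_bound (hc.measurable.comp_aemeasurable
      (hB.aemeasurable t)).aestronglyMeasurable M (.of_forall fun ω => hb _)
  have hint1 (t : ℝ≥0) : Integrable (fun ω => f (p + L (B t ω))) P :=
    hint hg.continuous (fun v => hM _) t
  by_cases hp : p.fst = p.snd
  · have h (t : ℝ≥0) (ω : Ω) : f (reflectionCoupling B p t ω) = f (p + L (B t ω)) := by
      rw [reflectionCoupling_of_fst_eq_snd hp]
    simp only [transitionOp, h]
    exact ⟨hint1, hlim⟩
  have hint2 (t : ℝ≥0) :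
      Integrable (fun ω => f (WithLp.toLp 2 (p.fst + B t ω, p.fst + B t ω))) P :=
    hint (h := fun v => f (WithLp.toLp 2 (p.fst + v, p.fst + v)))
      (by fun_prop) (fun v => hM _) t
  let A (t : ℝ≥0) : Set Ω :=
    {ω | (t : ℝ≥0∞) < hitTime (mirror p.fst p.snd) fun s => p.fst + B s ω}
  have hA (t : ℝ≥0) : NullMeasurableSet (A t) P := hB.nullMeasurableSet_lt_hitTime hp t
  have hcint (t : ℝ≥0) : Integrable (fun ω => f (reflectionCoupling B p t ω)) P := by
    refine (((hint1 t).indicator₀ (hA t)).add ((hint2 t).indicator₀ (hA t).compl)).congr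
      (.of_forall fun ω => ?_)
    by_cases hω : ω ∈ A t
    · simp [hω, reflectionCoupling_of_lt_hitTime hω, L]
    · simp [hω, reflectionCoupling_of_not_lt_hitTime hω]
  refine ⟨hcint, ?_⟩
  obtain ⟨C, hC⟩ := hB.exists_measure_hitTime_le_le hp
  have hM0 : 0 ≤ M := (abs_nonneg _).trans (hM p)
  -- The two integrands agree on `A t` and differ by at most 2M off it. The sign of `C` is unknown,
  -- hence `max C 0`.
  have hdiff (t : ℝ≥0) (ht : 0 < t) :
      |transitionOp (reflectionCoupling B) P t f p - ∫ ω, f (p + L (B t ω)) ∂P| ≤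
        2 * M * (max C 0 * (t : ℝ) ^ 2) := by
    rw [transitionOp, ← integral_sub (hcint t) (hint1 t)]
    calc _ ≤ ∫ ω, |f (reflectionCoupling B p t ω) - f (p + L (B t ω))| ∂P :=
          abs_integral_le_integral_abs
      _ ≤ ∫ ω, (A t)ᶜ.indicator (fun _ => 2 * M) ω ∂P := by
        refine integral_mono ((hcint t).sub (hint1 t)).abs
          ((integrable_const _).indicator₀ (hA t).compl) fun ω => ?_
        by_cases hω : ω ∈ A t
        · simp [hω, reflectionCoupling_of_lt_hitTime hω, L]
        · simp only [Set.indicator_of_mem (Set.mem_compl hω)]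
          have h1 := hM (reflectionCoupling B p t ω)
          have h2 := hM (p + L (B t ω))
          exact (abs_sub _ _).trans (by linarith)
      _ = 2 * M * P.real (A t)ᶜ := by
        rw [integral_indicator₀ (hA t).compl, setIntegral_const, smul_eq_mul, mul_comm]
      _ ≤ _ := by
        gcongr
        refine ENNReal.toReal_le_of_le_ofReal (by positivity) ((hC t ht).trans ?_)
        gcongr
        exact le_max_left _ _
  have hrest : Tendsto (fun t : ℝ≥0 => (transitionOp (reflectionCoupling B) P t f p -
      ∫ ω, f (p + L (B t ω)) ∂P) / (t : ℝ)) (𝓝[>] 0) (𝓝 0) := by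
    have hc : Continuous fun t : ℝ≥0 => 2 * M * (max C 0 * (t : ℝ)) := by fun_prop
    refine squeeze_zero_norm' ?_ ((hc.tendsto' 0 0 (by simp)).mono_left nhdsWithin_le_nhds)
    filter_upwards [self_mem_nhdsWithin] with t ht
    have ht' : (0 : ℝ) < t := NNReal.coe_pos.2 ht
    rw [Real.norm_eq_abs, abs_div, abs_of_pos ht', div_le_iff₀ ht']
    exact (hdiff t ht).trans_eq (by ring)
  have := hlim.add hrest
  rw [add_zero] at this
  refine this.congr fun t => ?_
  rw [← add_div]
  congr 1
  ring
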